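/- Let $\varphi=\frac{1+\sqrt5}{2}$ and let $x_{\rm F}=0100101001001\ldots$ be the infinite Fibonacci word, the limit of the words $f^k(0)$ for the morphism $f:0\mapsto 01,\ 1\mapsto 0$. Let $w$ be a non-empty factor of $x_{\rm F}$ that has no overlap in $x_{\rm F}$, i.e., there are no non-empty words $x,y,z$ such that $w=xy=yz$ and $xyz$ is a factor of $x_{\rm F}$. Write $x_{\rm F}=r_0(w)\,r_1(w)\,r_2(w)\cdots$, where $r_0(w)$ is the prefix of $x_{\rm F}$ that precedes the first occurrence of $w$ and, for $k\ge 1$, $r_k(w)$ is the block from the beginning of the $k$-th occurrence of $w$ up to (not including) the beginning of the $(k+1)$-st occurrence. Suppose that $$|r_0(w)|\le |r_1(w)|-|w|.\qquad\text{(SR0)}$$ Let $Y=Y_1Y_2Y_3\ldots$ be the infinite word over $\{0,1,2\}$ obtained from $x_{\rm F}$ by replacing every occurrence of $w$, consecutively from left to right, by the letter $2$, and let $Y^{-1}(a)=\{n\ge 1: Y_n=a\}$. Then each of the sets $Y^{-1}(0)$, $Y^{-1}(1)$, $Y^{-1}(2)$ is a union of finitely many (possibly no) strictly increasing generalized Beatty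 sequences $V(n)=p\lfloor n\varphi\rfloor+qn+r$ with integers $p,q,r$, each indexed either by $n\ge 1$ or by $n\ge 0$. -/

import Mathlib

/-- The block `x i, x (i+1), …, x (j-1)` of the infinite word `x` (letters indexed from `0`). -/
def wordSegment {A : Type*} (x : ℕ → A) (i j : ℕ) : List A :=
  (List.range (j - i)).map fun k => x (i + k)

/-- The finite word `w` occurs in the infinite word `x`, starting at index `i`. -/
def OccursAt {A : Type*} (x : ℕ → A) (w : List A) (i : ℕ) : Prop :=
  wordSegment x i (i + w.length) = w

instance {A : Type*} [DecidableEq A] (x : ℕ → A) (w : List A) : DecidablePred (OccursAt x w) :=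
  fun i => inferInstanceAs (Decidable (wordSegment x i (i + w.length) = w))

/-- `w` is a factor of `x`. -/
def IsFactor {A : Type*} (x : ℕ → A) (w : List A) : Prop :=
  ∃ i, OccursAt x w i

/-- `w` has an overlap in `x`: there are non-empty words `u`, `v`, `z` with `w = uv = vz`
such that `uvz` is a factor of `x`. -/
def HasOverlap {A : Type*} (x : ℕ → A) (w : List A) : Prop :=
  ∃ u v z : List A, u ≠ [] ∧ v ≠ [] ∧ z ≠ [] ∧ w = u ++ v ∧ w = v ++ z ∧
    IsFactor x (u ++ v ++ z)

/-- The decomposition `x = r₀(w) r₁(w) r₂(w) …` of `x` by the consecutive occurrences of `w`: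
`r₀(w)` is the prefix of `x` before the first occurrence, and `r_k(w)` (`k ≥ 1`) is the block from
the beginning of the `k`-th occurrence up to the beginning of the `(k+1)`-st one.
(`Nat.nth` counts from `0`; it is used for words `w` that occur infinitely often.) -/
noncomputable def returnWord {A : Type*} (x : ℕ → A) (w : List A) : ℕ → List A
  | 0 => wordSegment x 0 (Nat.nth (OccursAt x w) 0)
  | k + 1 => wordSegment x (Nat.nth (OccursAt x w) k) (Nat.nth (OccursAt x w) (k + 1))

/-- The Fibonacci morphism `0 ↦ 01`, `1 ↦ 0` on words over `{0, 1}`. -/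
def fibMorphism (u : List ℕ) : List ℕ :=
  u.flatMap fun a => if a = 0 then [0, 1] else [0]

/-- The infinite Fibonacci word `0100101001001…`, the limit of the words `f^k(0)` for the Fibonacci
morphism `f`. These words are prefixes of each other and `f^n(0)` has more than `n` letters, so the
letter with index `n` can be read off from `f^n(0)`. -/
def fibWord (n : ℕ) : ℕ :=
  (fibMorphism^[n] [0]).getD n 0

/-- Reading `x` from left to right and replacing `w` by a single letter whenever it is met:
`replaceStart x w n` is the index in `x` at which the piece of `x` begins that becomes the letter
with index `n` of the new word. -/
def replaceStart {A : Type*} [DecidableEq A] (x : ℕ → A) (w : List A) : ℕ → ℕ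
  | 0 => 0
  | n + 1 =>
    if OccursAt x w (replaceStart x w n) then replaceStart x w n + w.length
    else replaceStart x w n + 1

/-- The transform `T : [w ↦ c]`: the infinite word obtained from `x` by replacing, consecutively
from left to right, the occurrences of `w` by the letter `c`. -/
def wordReplace {A : Type*} [DecidableEq A] (w : List A) (c : A) (x : ℕ → A) (n : ℕ) : A :=
  if OccursAt x w (replaceStart x w n) then c else x (replaceStart x w n)

/-- `y⁻¹(a)`: the set of positions of the letter `a` in the infinite word `y`, where the first letter
of `y` has position `1`. -/
def letterPositions {A : Type*} (y : ℕ → A) (a : A) : Set ℤ :=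
  {m | ∃ n : ℕ, y n = a ∧ m = (n : ℤ) + 1}

/-- `V` is a generalized Beatty sequence for `α`: `V(n) = p⌊nα⌋ + qn + r` with integers
`p`, `q`, `r`. -/
def IsGBS (α : ℝ) (V : ℕ → ℤ) : Prop :=
  ∃ p q r : ℤ, ∀ n : ℕ, V n = p * ⌊(n : ℝ) * α⌋ + q * (n : ℤ) + r

/-- `S` is the union of finitely many (possibly no) strictly increasing generalized Beatty sequences
for `α`, each of which is indexed either by `{0, 1, 2, …}` or by `{1, 2, 3, …}`. -/
def IsFiniteUnionGBS (α : ℝ) (S : Set ℤ) : Prop :=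
  ∃ (k : ℕ) (V : Fin k → ℕ → ℤ) (s : Fin k → ℕ),
    (∀ i, IsGBS α (V i) ∧ (s i = 0 ∨ s i = 1) ∧ StrictMonoOn (V i) (Set.Ici (s i))) ∧
      S = ⋃ i, V i '' Set.Ici (s i)

/-! Write `x` for the Fibonacci word and `f` for its morphism. For every factor `w` there are words
`r`, `u`, `v` with `x = r σ(x)`, `σ : 0 ↦ u, 1 ↦ v`, such that `w` occurs exactly where a block
`σ(a)` begins (`exists_isReturnDecomposition`). This goes by induction on `|w|`: a factor starting
with `0` occurs exactly at the `f`-images of the occurrences of a shorter word, and since `x =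
f(x)`, applying `f` to the decomposition of the shorter word gives that of `w`. A factor starting
with `1` is always preceded by `0`, and the decomposition is conjugated by that letter.

If `w` has no overlap, then `u = ws` and `v = wt`, so `Y = r τ(x)` with `τ : 0 ↦ 2s, 1 ↦ 2t`. The
induction also keeps `r` and `u` suffixes of a common word, without tracking which is longer; (SR0)
says `|r| ≤ |s|`, so `r` is a suffix of `s`.

The first `n` letters of `x` contain `⌊(n+1)φ⌋ - (n+1)` zeros (`floor_mul_goldenRatio`), so a fixed
place in the successive blocks `τ(0)`, or `τ(1)`, runs through a generalized Beatty sequence indexed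
by `n ≥ 1`. The prefix `r` is the tail of a virtual block `τ(0)` before the first one; its letters
are the values at `n = 0` (`isFiniteUnionGBS_letterPositions`). -/

/-! ### Occurrences of finite words and overlaps. -/

section Occurrences

variable {A : Type*} {x : ℕ → A}

theorem length_wordSegment (x : ℕ → A) (i j : ℕ) : (wordSegment x i j).length = j - i := by
  simp [wordSegment]

theorem occursAt_iff {w : List A} {i : ℕ} :
    OccursAt x w i ↔ ∀ (j : ℕ) (h : j < w.length), w[j] = x (i + j) := by
  unfold OccursAt wordSegment
  constructor
  · intro h j hj
    have := List.getElem_of_eq h.symm hj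
    simpa using this
  · intro h
    apply List.ext_getElem
    · simp
    · intro j h1 h2
      simpa using (h j h2).symm

theorem occursAt_nil (x : ℕ → A) (i : ℕ) : OccursAt x [] i := by simp [occursAt_iff]

theorem occursAt_append {a b : List A} {i : ℕ} :
    OccursAt x (a ++ b) i ↔ OccursAt x a i ∧ OccursAt x b (i + a.length) := by
  simp only [occursAt_iff]
  constructor
  · intro h
    refine ⟨fun j hj => ?_, fun j hj => ?_⟩
    · have := h j (by simp; omega)
      rwa [List.getElem_append_left hj] at this
    · have := h (a.length + j) (by simp; omega)
      rw [List.getElem_append_right (by omega)] at this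
      simpa [add_assoc] using this
  · rintro ⟨ha, hb⟩ j hj
    by_cases hja : j < a.length
    · rw [List.getElem_append_left hja]
      exact ha j hja
    · rw [List.getElem_append_right (by omega), hb (j - a.length) (by simp at hj; omega)]
      congr 1
      omega

theorem occursAt_singleton {a : A} {i : ℕ} : OccursAt x [a] i ↔ x i = a := by
  simp [occursAt_iff, eq_comm]

theorem occursAt_cons {a : A} {l : List A} {i : ℕ} :
    OccursAt x (a :: l) i ↔ x i = a ∧ OccursAt x l (i + 1) := by
  rw [← List.singleton_append, occursAt_append, occursAt_singleton]
  simp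

theorem occursAt_wordSegment (x : ℕ → A) (i j : ℕ) : OccursAt x (wordSegment x i j) i := by
  rw [occursAt_iff]
  intro k hk
  simp [wordSegment]

theorem OccursAt.prefix_of_length_le {a b : List A} {i : ℕ} (ha : OccursAt x a i)
    (hb : OccursAt x b i) (hab : a.length ≤ b.length) : a <+: b := by
  rw [occursAt_iff] at ha hb
  rw [List.prefix_iff_eq_take]
  apply List.ext_getElem
  · simp [hab]
  · intro j h1 h2
    rw [List.getElem_take, ha j h1, hb j (by omega)]

theorem OccursAt.of_prefix {a b : List A} {i : ℕ} (hb : OccursAt x b i) (hab : a <+: b) :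
    OccursAt x a i := by
  obtain ⟨t, rfl⟩ := hab
  exact (occursAt_append.1 hb).1

theorem OccursAt.eq_of_length_eq {a b : List A} {i : ℕ} (ha : OccursAt x a i)
    (hb : OccursAt x b i) (hab : a.length = b.length) : a = b :=
  (ha.prefix_of_length_le hb hab.le).eq_of_length hab

theorem OccursAt.eq_wordSegment {a : List A} (ha : OccursAt x a 0) :
    a = wordSegment x 0 a.length :=
  ha.eq_of_length_eq (occursAt_wordSegment x 0 _) (by simp [length_wordSegment])

theorem wordSegment_zero_succ (x : ℕ → A) (n : ℕ) :
    wordSegment x 0 (n + 1) = wordSegment x 0 n ++ [x n] := by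
  simp [wordSegment, List.range_succ]

/-- Two occurrences of `w` at a distance less than `|w|` produce an overlap. -/
theorem hasOverlap_of_occursAt {w : List A} {i d : ℕ} (h0 : OccursAt x w i)
    (h1 : OccursAt x w (i + d)) (hd : 0 < d) (hdw : d < w.length) : HasOverlap x w := by
  have e1 : w = w.take d ++ w.drop d := (List.take_append_drop d w).symm
  have e2 : w = w.take (w.length - d) ++ w.drop (w.length - d) :=
    (List.take_append_drop _ w).symm
  have o1 := h0
  rw [e1, occursAt_append] at o1
  have o2 := h1
  rw [e2, occursAt_append] at o2
  -- Both words are read in `x` at index `i + d` and have the same length.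
  have e3 : w.drop d = w.take (w.length - d) := by
    refine OccursAt.eq_of_length_eq o1.2 (i := i + (w.take d).length) ?_ (by simp)
    have : i + (w.take d).length = i + d := by simp; omega
    rw [this]
    exact o2.1
  refine ⟨w.take d, w.drop d, w.drop (w.length - d), ?_, ?_, ?_, e1, ?_, i, ?_⟩
  · exact List.ne_nil_of_length_pos (by simp; omega)
  · exact List.ne_nil_of_length_pos (by simp; omega)
  · exact List.ne_nil_of_length_pos (by simp; omega)
  · rw [e3]; exact e2
  · rw [← e1, occursAt_append]
    refine ⟨h0, ?_⟩
    have : i + w.length = i + d + (w.take (w.length - d)).length := by simp; omega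
    rw [this]
    exact o2.2

end Occurrences

/-! ### Morphisms and the Fibonacci word as a fixed point. -/

/-- The morphism `0 ↦ u`, `1 ↦ v` on words over `{0, 1}`. -/
def blockMap (u v l : List ℕ) : List ℕ :=
  l.flatMap fun a => if a = 0 then u else v

@[simp] theorem blockMap_nil (u v : List ℕ) : blockMap u v [] = [] := rfl

theorem blockMap_append (u v l m : List ℕ) :
    blockMap u v (l ++ m) = blockMap u v l ++ blockMap u v m := by
  simp [blockMap]

theorem blockMap_cons (u v : List ℕ) (a : ℕ) (l : List ℕ) :
    blockMap u v (a :: l) = (if a = 0 then u else v) ++ blockMap u v l := rfl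

theorem blockMap_singleton (u v : List ℕ) (a : ℕ) :
    blockMap u v [a] = if a = 0 then u else v := by
  simp [blockMap]

theorem fibMorphism_nil : fibMorphism [] = [] := rfl

theorem fibMorphism_append (l m : List ℕ) :
    fibMorphism (l ++ m) = fibMorphism l ++ fibMorphism m :=
  blockMap_append _ _ l m

theorem fibMorphism_cons (a : ℕ) (l : List ℕ) :
    fibMorphism (a :: l) = (if a = 0 then [0, 1] else [0]) ++ fibMorphism l := rfl

theorem fibMorphism_singleton (a : ℕ) :
    fibMorphism [a] = if a = 0 then [0, 1] else [0] := by
  simp [fibMorphism]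

theorem fibMorphism_blockMap (u v l : List ℕ) :
    fibMorphism (blockMap u v l) = blockMap (fibMorphism u) (fibMorphism v) l := by
  induction l with
  | nil => rfl
  | cons a l ih =>
    rw [blockMap_cons, blockMap_cons, fibMorphism_append, ih]
    split_ifs <;> rfl

theorem fibMorphism_prefix {l m : List ℕ} (h : l <+: m) : fibMorphism l <+: fibMorphism m := by
  obtain ⟨t, rfl⟩ := h
  rw [fibMorphism_append]
  exact List.prefix_append _ _

theorem fibMorphism_suffix {l m : List ℕ} (h : l <:+ m) : fibMorphism l <:+ fibMorphism m := by
  obtain ⟨t, rfl⟩ := h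
  rw [fibMorphism_append]
  exact List.suffix_append _ _

theorem fibMorphism_eq_cons {l : List ℕ} (h : l ≠ []) : ∃ t, fibMorphism l = 0 :: t := by
  cases l with
  | nil => exact absurd rfl h
  | cons a l =>
    rw [fibMorphism_cons]
    split_ifs
    · exact ⟨_, rfl⟩
    · exact ⟨_, rfl⟩

theorem length_le_length_fibMorphism (l : List ℕ) : l.length ≤ (fibMorphism l).length := by
  induction l with
  | nil => simp
  | cons a l ih =>
    rw [fibMorphism_cons]
    split_ifs <;> simp <;> omega

theorem fibIterate_eq_cons (n : ℕ) : ∃ t, fibMorphism^[n] [0] = 0 :: t := by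
  induction n with
  | zero => exact ⟨[], rfl⟩
  | succ n ih =>
    obtain ⟨t, ht⟩ := ih
    rw [Function.iterate_succ_apply', ht]
    exact fibMorphism_eq_cons (by simp)

theorem fibIterate_prefix_succ (n : ℕ) : fibMorphism^[n] [0] <+: fibMorphism^[n + 1] [0] := by
  induction n with
  | zero => exact ⟨[1], rfl⟩
  | succ n ih =>
    rw [Function.iterate_succ_apply', Function.iterate_succ_apply' fibMorphism (n + 1)]
    exact fibMorphism_prefix ih

theorem fibIterate_prefix {m n : ℕ} (h : m ≤ n) : fibMorphism^[m] [0] <+: fibMorphism^[n] [0] := by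
  induction n, h using Nat.le_induction with
  | base => exact List.prefix_rfl
  | succ n _ ih => exact ih.trans (fibIterate_prefix_succ n)

theorem lt_length_fibIterate (n : ℕ) : n < (fibMorphism^[n] [0]).length := by
  induction n with
  | zero => simp
  | succ n ih =>
    obtain ⟨t, ht⟩ := fibIterate_eq_cons n
    rw [Function.iterate_succ_apply']
    rw [ht] at ih ⊢
    rw [fibMorphism_cons]
    have := length_le_length_fibMorphism t
    simp at ih ⊢
    omega

/-- The letter with index `j` is defined through the `j`-th iterate; the iterates are prefixes of
one another, so any iterate long enough gives the same letter. -/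
theorem occursAt_fibIterate (n : ℕ) : OccursAt fibWord (fibMorphism^[n] [0]) 0 := by
  rw [occursAt_iff]
  intro j hj
  have hj' := lt_length_fibIterate j
  rw [zero_add, fibWord, List.getD_eq_getElem _ _ hj']
  rcases le_total n j with h | h
  · exact (fibIterate_prefix h).getElem hj
  · exact ((fibIterate_prefix h).getElem hj').symm

/-- The Fibonacci word is a fixed point of the Fibonacci morphism. -/
theorem occursAt_fibMorphism {l : List ℕ} (h : OccursAt fibWord l 0) :
    OccursAt fibWord (fibMorphism l) 0 := by
  have h1 : l <+: fibMorphism^[l.length] [0] :=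
    h.prefix_of_length_le (occursAt_fibIterate _) (lt_length_fibIterate _).le
  have h2 := fibMorphism_prefix h1
  rw [← Function.iterate_succ_apply' fibMorphism] at h2
  exact (occursAt_fibIterate _).of_prefix h2

theorem fibWord_zero : fibWord 0 = 0 := rfl

theorem fibWord_one : fibWord 1 = 1 := rfl

/-- The prefix of length `n` of the Fibonacci word. -/
def fibPrefix (n : ℕ) : List ℕ := wordSegment fibWord 0 n

@[simp] theorem length_fibPrefix (n : ℕ) : (fibPrefix n).length = n := length_wordSegment _ _ _

theorem occursAt_fibPrefix (n : ℕ) : OccursAt fibWord (fibPrefix n) 0 :=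
  occursAt_wordSegment _ _ _

@[simp] theorem fibPrefix_zero : fibPrefix 0 = [] := rfl

theorem fibPrefix_succ (n : ℕ) : fibPrefix (n + 1) = fibPrefix n ++ [fibWord n] :=
  wordSegment_zero_succ _ _

/-! ### Cutting the Fibonacci word into the images of its letters. -/

/-- The position in the Fibonacci word at which the image of its letter with index `n` under the
Fibonacci morphism begins. -/
def fibImageStart (n : ℕ) : ℕ := (fibMorphism (fibPrefix n)).length

theorem fibImageStart_succ (n : ℕ) :
    fibImageStart (n + 1) = fibImageStart n + if fibWord n = 0 then 2 else 1 := by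
  rw [fibImageStart, fibPrefix_succ, fibMorphism_append, List.length_append, fibMorphism_singleton,
    fibImageStart]
  split_ifs <;> rfl

theorem occursAt_fibImageStart (n : ℕ) :
    OccursAt fibWord (if fibWord n = 0 then [0, 1] else [0]) (fibImageStart n) := by
  have h := occursAt_fibMorphism (occursAt_fibPrefix (n + 1))
  rw [fibPrefix_succ, fibMorphism_append, occursAt_append, fibMorphism_singleton, zero_add] at h
  exact h.2

theorem fibWord_fibImageStart (n : ℕ) : fibWord (fibImageStart n) = 0 := by
  have h := occursAt_fibImageStart n
  split_ifs at h
  · exact (occursAt_cons.1 h).1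
  · exact occursAt_singleton.1 h

theorem fibWord_fibImageStart_add_one {n : ℕ} (hn : fibWord n = 0) :
    fibWord (fibImageStart n + 1) = 1 := by
  have h := occursAt_fibImageStart n
  rw [if_pos hn, occursAt_cons, occursAt_singleton] at h
  exact h.2

theorem exists_fibImageStart (i : ℕ) :
    ∃ n, i = fibImageStart n ∨ (i = fibImageStart n + 1 ∧ fibWord n = 0) := by
  induction i with
  | zero => exact ⟨0, Or.inl rfl⟩
  | succ i ih =>
    obtain ⟨n, rfl | ⟨rfl, hn⟩⟩ := ih
    · by_cases hn : fibWord n = 0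
      · exact ⟨n, Or.inr ⟨rfl, hn⟩⟩
      · exact ⟨n + 1, Or.inl (by rw [fibImageStart_succ, if_neg hn])⟩
    · exact ⟨n + 1, Or.inl (by rw [fibImageStart_succ, if_pos hn])⟩

theorem fibWord_eq_zero_iff {i : ℕ} : fibWord i = 0 ↔ ∃ n, i = fibImageStart n := by
  constructor
  · intro h
    obtain ⟨n, hn | ⟨rfl, hn⟩⟩ := exists_fibImageStart i
    · exact ⟨n, hn⟩
    · rw [fibWord_fibImageStart_add_one hn] at h
      exact absurd h one_ne_zero
  · rintro ⟨n, rfl⟩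
    exact fibWord_fibImageStart n

theorem fibWord_eq_zero_or_one (i : ℕ) : fibWord i = 0 ∨ fibWord i = 1 := by
  obtain ⟨n, rfl | ⟨rfl, hn⟩⟩ := exists_fibImageStart i
  · exact Or.inl (fibWord_fibImageStart n)
  · exact Or.inr (fibWord_fibImageStart_add_one hn)

theorem fibWord_ne_zero_iff {i : ℕ} :
    fibWord i ≠ 0 ↔ ∃ n, fibWord n = 0 ∧ i = fibImageStart n + 1 := by
  constructor
  · intro h
    obtain ⟨n, rfl | ⟨rfl, hn⟩⟩ := exists_fibImageStart i
    · exact absurd (fibWord_fibImageStart n) h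
    · exact ⟨n, hn, rfl⟩
  · rintro ⟨n, hn, rfl⟩
    rw [fibWord_fibImageStart_add_one hn]
    exact one_ne_zero

theorem fibWord_succ_eq_zero {i : ℕ} (h : fibWord i ≠ 0) : fibWord (i + 1) = 0 := by
  obtain ⟨n, hn, rfl⟩ := fibWord_ne_zero_iff.1 h
  refine fibWord_eq_zero_iff.2 ⟨n + 1, ?_⟩
  rw [fibImageStart_succ, if_pos hn]

/-- Desubstitution: the occurrences of `f(l) 0` are the images of the occurrences of `l`. -/
theorem occursAt_fibMorphism_append_zero {l : List ℕ} (hl : ∀ a ∈ l, a = 0 ∨ a = 1) (n : ℕ) :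
    OccursAt fibWord (fibMorphism l ++ [0]) (fibImageStart n) ↔ OccursAt fibWord l n := by
  induction l generalizing n with
  | nil =>
    simp only [fibMorphism_nil, List.nil_append, occursAt_singleton, occursAt_nil, iff_true]
    exact fibWord_fibImageStart n
  | cons a l ih =>
    have hl' : ∀ b ∈ l, b = 0 ∨ b = 1 := fun b hb => hl b (List.mem_cons_of_mem _ hb)
    rw [occursAt_cons, ← ih hl', fibImageStart_succ, fibMorphism_cons, List.append_assoc,
      occursAt_append]
    rcases hl a List.mem_cons_self with rfl | rfl
    · by_cases hn : fibWord n = 0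
      · have := occursAt_fibImageStart n
        rw [if_pos hn] at this
        simp [hn, this]
      -- The image of a letter other than `0` is the single letter `0`, and the next image again
      -- starts with `0`, so `01` cannot be read here.
      · simp only [if_true, hn, false_and, iff_false, not_and]
        intro h
        rw [occursAt_cons, occursAt_singleton] at h
        have h2 := fibWord_fibImageStart (n + 1)
        rw [fibImageStart_succ, if_neg hn, h.2] at h2
        exact absurd h2 one_ne_zero
    · rw [if_neg one_ne_zero]
      by_cases hn : fibWord n = 0
      -- Here `x` reads `01`, while `f(1) f(l) 0` starts with `00`; for empty `l` it is the appended
      -- `0` that tells `f(1)` from a prefix of `f(0)`.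
      · simp only [hn, zero_ne_one, false_and, iff_false, not_and]
        intro _ h
        have h3 : fibWord (fibImageStart n + 1) = 0 := by
          by_cases hnil : l = []
          · subst hnil
            exact occursAt_singleton.1 h
          · obtain ⟨t, ht⟩ := fibMorphism_eq_cons hnil
            rw [ht] at h
            exact (occursAt_cons.1 h).1
        rw [fibWord_fibImageStart_add_one hn] at h3
        exact one_ne_zero h3
      · have := (fibWord_eq_zero_or_one n).resolve_left hn
        simp [this, occursAt_singleton, fibWord_fibImageStart n]

theorem occursAt_fibMorphism_append_zero_iff {l : List ℕ} (hl : ∀ a ∈ l, a = 0 ∨ a = 1) (i : ℕ) :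
    OccursAt fibWord (fibMorphism l ++ [0]) i ↔
      ∃ n, OccursAt fibWord l n ∧ i = fibImageStart n := by
  constructor
  · intro h
    have h0 : fibWord i = 0 := by
      by_cases hnil : l = []
      · subst hnil
        exact occursAt_singleton.1 h
      · obtain ⟨t, ht⟩ := fibMorphism_eq_cons hnil
        rw [ht] at h
        exact (occursAt_cons.1 h).1
    obtain ⟨n, rfl⟩ := fibWord_eq_zero_iff.1 h0
    exact ⟨n, (occursAt_fibMorphism_append_zero hl n).1 h, rfl⟩
  · rintro ⟨n, hn, rfl⟩
    exact (occursAt_fibMorphism_append_zero hl n).2 hn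

/-- A factor of the Fibonacci word that begins with `0` occurs where some `f(l) 0` occurs. -/
theorem exists_desubstitution (t : List ℕ) (h : IsFactor fibWord (0 :: t)) :
    ∃ l : List ℕ, (∀ a ∈ l, a = 0 ∨ a = 1) ∧ l.length ≤ t.length ∧
      (t.head? = some 1 → l.head? = some 0) ∧
      ∀ i, OccursAt fibWord (0 :: t) i ↔ OccursAt fibWord (fibMorphism l ++ [0]) i := by
  induction hk : t.length using Nat.strong_induction_on generalizing t with
  | _ k ih =>
    subst hk
    obtain ⟨i, hi⟩ := h
    match t with
    | [] => exact ⟨[], by simp, by simp, by simp, fun i => Iff.rfl⟩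
    | a :: t =>
      have ha : a = 0 ∨ a = 1 := by
        rw [occursAt_cons, occursAt_cons] at hi
        rw [← hi.2.1]
        exact fibWord_eq_zero_or_one _
      rcases ha with rfl | rfl
      · obtain ⟨l, hl, hlen, -, hocc⟩ := ih t.length (by simp) t ⟨i + 1, (occursAt_cons.1 hi).2⟩ rfl
        refine ⟨1 :: l, by simpa using hl, by simpa using hlen, by simp, fun i => ?_⟩
        rw [occursAt_cons, hocc, fibMorphism_cons, if_neg one_ne_zero, List.append_assoc,
          List.singleton_append, occursAt_cons]
      · match t with
        | [] =>
          -- A `1` is always followed by `0`, so `01` occurs exactly where `010 = f(0) 0` does.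
          refine ⟨[0], by simp, by simp, by simp, fun i => ?_⟩
          simp only [fibMorphism_singleton, if_true, List.cons_append, List.nil_append,
            occursAt_cons, occursAt_nil, and_true]
          refine ⟨fun h => ⟨h.1, h.2, ?_⟩, fun h => ⟨h.1, h.2.1⟩⟩
          exact fibWord_succ_eq_zero (by rw [h.2]; exact one_ne_zero)
        | b :: t =>
          have hb : b = 0 := by
            simp only [occursAt_cons] at hi
            rw [← hi.2.2.1]
            exact fibWord_succ_eq_zero (by rw [hi.2.1]; exact one_ne_zero)
          subst hb
          obtain ⟨l, hl, hlen, -, hocc⟩ := ih t.length (by simp) t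
            ⟨i + 1 + 1, (occursAt_cons.1 (occursAt_cons.1 hi).2).2⟩ rfl
          refine ⟨0 :: l, by simpa using hl, by simp; omega, by simp, fun i => ?_⟩
          rw [occursAt_cons, occursAt_cons, hocc, fibMorphism_cons, if_pos rfl]
          simp only [List.cons_append, List.nil_append, occursAt_cons]

/-! ### Return words of a factor. -/

/-- The Fibonacci word is `r σ(x)` for the morphism `σ : 0 ↦ u, 1 ↦ v`, the occurrences of `w` are
the beginnings of the blocks `σ(a)`, and `r` and `u` are suffixes of a common word. -/
structure IsReturnDecomposition (w r u v : List ℕ) : Prop where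
  left_ne_nil : u ≠ []
  right_ne_nil : v ≠ []
  occursAt : ∀ k, OccursAt fibWord (r ++ blockMap u v (fibPrefix k)) 0
  occursAt_iff : ∀ i, OccursAt fibWord w i ↔ ∃ k, i = (r ++ blockMap u v (fibPrefix k)).length
  suffix : ∃ W, r <:+ W ∧ u <:+ W

theorem isReturnDecomposition_nil : IsReturnDecomposition [] [] [0] [1] := by
  have key : ∀ k, blockMap [0] [1] (fibPrefix k) = fibPrefix k := by
    intro k
    induction k with
    | zero => rfl
    | succ k ih =>
      rw [fibPrefix_succ, blockMap_append, ih, blockMap_singleton]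
      rcases fibWord_eq_zero_or_one k with h | h <;> simp [h]
  refine ⟨by simp, by simp, fun k => ?_, fun i => ?_, [0], List.nil_suffix, List.suffix_rfl⟩
  · rw [key, List.nil_append]
    exact occursAt_fibPrefix k
  · simp only [key, List.nil_append, length_fibPrefix, exists_eq', occursAt_nil]

/-- Apply `f` to `x = r σ(x)`: the prefix before a block is mapped to the prefix before the image
block, whose length is by definition the value of `fibImageStart`. Suffixes are preserved by `f`. -/
theorem IsReturnDecomposition.desubstitute {w r u v : List ℕ}
    (h : IsReturnDecomposition w r u v) {l : List ℕ}
    (hl : ∀ i, OccursAt fibWord l i ↔ ∃ n, OccursAt fibWord w n ∧ i = fibImageStart n) :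
    IsReturnDecomposition l (fibMorphism r) (fibMorphism u) (fibMorphism v) := by
  have key : ∀ k, fibMorphism (r ++ blockMap u v (fibPrefix k)) =
      fibMorphism r ++ blockMap (fibMorphism u) (fibMorphism v) (fibPrefix k) := fun k => by
    rw [fibMorphism_append, fibMorphism_blockMap]
  obtain ⟨W, hr, hu⟩ := h.suffix
  refine ⟨?_, ?_, fun k => ?_, fun i => ?_, fibMorphism W, fibMorphism_suffix hr,
    fibMorphism_suffix hu⟩
  · obtain ⟨t, ht⟩ := fibMorphism_eq_cons h.left_ne_nil
    simp [ht]
  · obtain ⟨t, ht⟩ := fibMorphism_eq_cons h.right_ne_nil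
    simp [ht]
  · rw [← key]
    exact occursAt_fibMorphism (h.occursAt k)
  · have hstart : ∀ k, fibImageStart (r ++ blockMap u v (fibPrefix k)).length =
        (fibMorphism r ++ blockMap (fibMorphism u) (fibMorphism v) (fibPrefix k)).length := by
      intro k
      rw [fibImageStart, fibPrefix, ← (h.occursAt k).eq_wordSegment, key]
    rw [hl]
    simp only [h.occursAt_iff]
    constructor
    · rintro ⟨n, ⟨k, rfl⟩, rfl⟩
      exact ⟨k, hstart k⟩
    · rintro ⟨k, rfl⟩
      exact ⟨_, ⟨k, rfl⟩, (hstart k).symm⟩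

theorem blockMap_conjugate (a : ℕ) (u v l : List ℕ) :
    [a] ++ blockMap (u ++ [a]) (v ++ [a]) l = blockMap (a :: u) (a :: v) l ++ [a] := by
  induction l with
  | nil => rfl
  | cons b l ih =>
    rw [blockMap_cons, blockMap_cons, List.append_assoc, ← ih]
    split_ifs <;> simp

/-- If `w` is preceded by `0` at every occurrence, the decomposition for `0w` can be conjugated. -/
theorem IsReturnDecomposition.shift {w r u v : List ℕ}
    (h : IsReturnDecomposition (0 :: w) r (0 :: u) (0 :: v))
    (hw : ∀ i, OccursAt fibWord w i ↔ ∃ n, OccursAt fibWord (0 :: w) n ∧ i = n + 1) :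
    IsReturnDecomposition w (r ++ [0]) (u ++ [0]) (v ++ [0]) := by
  have key : ∀ k, r ++ [0] ++ blockMap (u ++ [0]) (v ++ [0]) (fibPrefix k) =
      (r ++ blockMap (0 :: u) (0 :: v) (fibPrefix k)) ++ [0] := fun k => by
    rw [List.append_assoc, blockMap_conjugate, List.append_assoc]
  obtain ⟨W, hr, hu⟩ := h.suffix
  -- If `r` and `0u` are suffixes of `W`, then `r0` and `u0` are suffixes of `W0`.
  refine ⟨by simp, by simp, fun k => ?_, fun i => ?_, W ++ [0], ?_, ?_⟩
  · rw [key, occursAt_append]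
    refine ⟨h.occursAt k, ?_⟩
    rw [zero_add, occursAt_singleton]
    exact (occursAt_cons.1 ((h.occursAt_iff _).2 ⟨k, rfl⟩)).1
  · rw [hw]
    have hlen : ∀ s : List ℕ, (s ++ [0]).length = s.length + 1 := fun s => by simp
    simp only [h.occursAt_iff, key, hlen]
    constructor
    · rintro ⟨n, ⟨k, rfl⟩, rfl⟩
      exact ⟨k, rfl⟩
    · rintro ⟨k, rfl⟩
      exact ⟨_, ⟨k, rfl⟩, rfl⟩
  · obtain ⟨t, rfl⟩ := hr
    exact ⟨t, by simp⟩
  · obtain ⟨t, rfl⟩ := hu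
    exact ⟨t ++ [0], by simp⟩

/-- The `f`-image of a non-empty word starts with `0`; exposing this letter in both blocks is what
`IsReturnDecomposition.shift` needs. -/
theorem exists_isReturnDecomposition_of_zero_cons {t : List ℕ}
    (hfac : IsFactor fibWord (0 :: t))
    (ih : ∀ l : List ℕ, l.length ≤ t.length → (t.head? = some 1 → l.head? = some 0) →
      IsFactor fibWord l → ∃ r u v, IsReturnDecomposition l r u v) :
    ∃ r u v, IsReturnDecomposition (0 :: t) r (0 :: u) (0 :: v) := by
  obtain ⟨l, hl, hlen, hhead, hocc⟩ := exists_desubstitution t hfac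
  have hocc' : ∀ i, OccursAt fibWord (0 :: t) i ↔
      ∃ n, OccursAt fibWord l n ∧ i = fibImageStart n := fun i =>
    (hocc i).trans (occursAt_fibMorphism_append_zero_iff hl i)
  obtain ⟨i, hi⟩ := hfac
  obtain ⟨n, hn, -⟩ := (hocc' i).1 hi
  obtain ⟨r, u, v, h⟩ := ih l hlen hhead ⟨n, hn⟩
  obtain ⟨u', hu⟩ := fibMorphism_eq_cons h.left_ne_nil
  obtain ⟨v', hv⟩ := fibMorphism_eq_cons h.right_ne_nil
  refine ⟨fibMorphism r, u', v', ?_⟩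
  rw [← hu, ← hv]
  exact h.desubstitute hocc'

/-- Every `1` is the second letter of an image `01`. -/
theorem occursAt_one_cons_iff (t : List ℕ) (i : ℕ) :
    OccursAt fibWord (1 :: t) i ↔ ∃ n, OccursAt fibWord (0 :: 1 :: t) n ∧ i = n + 1 := by
  constructor
  · intro h
    obtain ⟨h1, h2⟩ := occursAt_cons.1 h
    obtain ⟨n, hn, rfl⟩ := fibWord_ne_zero_iff.1 (show fibWord i ≠ 0 by simp [h1])
    exact ⟨_, occursAt_cons.2 ⟨fibWord_fibImageStart n, h⟩, rfl⟩
  · rintro ⟨n, hn, rfl⟩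
    exact (occursAt_cons.1 hn).2

/-- The return words of a factor of the Fibonacci word form a Fibonacci word. -/
theorem exists_isReturnDecomposition (w : List ℕ) (hfac : IsFactor fibWord w) :
    ∃ r u v, IsReturnDecomposition w r u v := by
  induction hk : w.length using Nat.strong_induction_on generalizing w with
  | _ k ih =>
    subst hk
    match w with
    | [] => exact ⟨_, _, _, isReturnDecomposition_nil⟩
    | a :: t =>
      have ha : a = 0 ∨ a = 1 := by
        obtain ⟨i, hi⟩ := hfac
        rw [← (occursAt_cons.1 hi).1]
        exact fibWord_eq_zero_or_one _
      have hzero : ∀ s : List ℕ, s.length ≤ t.length → IsFactor fibWord (0 :: s) →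
          ∃ r u v, IsReturnDecomposition (0 :: s) r (0 :: u) (0 :: v) := fun s hs hf =>
        exists_isReturnDecomposition_of_zero_cons hf fun l hl _ hlf =>
          ih l.length (by simp; omega) l hlf rfl
      rcases ha with rfl | rfl
      · obtain ⟨r, u, v, h⟩ := hzero t le_rfl hfac
        exact ⟨_, _, _, h⟩
      · obtain ⟨i, hi⟩ := hfac
        obtain ⟨n, hn, -⟩ := (occursAt_one_cons_iff t i).1 hi
        -- Desubstituting `01t` may give a word as long as `1t`, out of reach of the induction. It
        -- then starts with `0`, and `hzero` desubstitutes once more.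
        obtain ⟨r, u, v, h⟩ : ∃ r u v, IsReturnDecomposition (0 :: 1 :: t) r (0 :: u) (0 :: v) := by
          refine exists_isReturnDecomposition_of_zero_cons ⟨n, hn⟩ fun l hl hd hlf => ?_
          rcases hl.lt_or_eq with hl | hl
          · exact ih l.length hl l hlf rfl
          · match l with
            | [] => simp at hl
            | b :: l =>
              obtain rfl : b = 0 := by simpa using hd
              obtain ⟨r, u, v, h⟩ := hzero l (by simpa using hl.le) hlf
              exact ⟨_, _, _, h⟩
        exact ⟨_, _, _, h.shift (occursAt_one_cons_iff t)⟩

/-! ### Counting zeros: the golden ratio enters. -/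

/-- The number of letters `0` among the first `n` letters of the Fibonacci word. -/
def fibZeros (n : ℕ) : ℕ := (fibPrefix n).count 0

theorem fibZeros_zero : fibZeros 0 = 0 := rfl

theorem fibZeros_succ (n : ℕ) :
    fibZeros (n + 1) = fibZeros n + if fibWord n = 0 then 1 else 0 := by
  rw [fibZeros, fibPrefix_succ, List.count_append, fibZeros, List.count_singleton]
  simp

theorem fibImageStart_eq (n : ℕ) : fibImageStart n = n + fibZeros n := by
  induction n with
  | zero => rfl
  | succ n ih =>
    rw [fibImageStart_succ, fibZeros_succ, ih]
    split_ifs <;> omega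

/-- Each image `01` or `0` contains exactly one `0`. -/
theorem fibZeros_fibImageStart (n : ℕ) : fibZeros (fibImageStart n) = n := by
  induction n with
  | zero => rfl
  | succ n ih =>
    rw [fibImageStart_succ]
    split_ifs with h
    · rw [fibZeros_succ, fibZeros_succ, ih, if_pos (fibWord_fibImageStart n),
        if_neg (by rw [fibWord_fibImageStart_add_one h]; exact one_ne_zero)]
    · rw [fibZeros_succ, ih, if_pos (fibWord_fibImageStart n)]

theorem fibZeros_fibImageStart_add_one (n : ℕ) : fibZeros (fibImageStart n + 1) = n + 1 := by
  rw [fibZeros_succ, fibZeros_fibImageStart, if_pos (fibWord_fibImageStart n)]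

theorem fibZeros_le (n : ℕ) : fibZeros n ≤ n := by
  simpa [fibZeros] using List.count_le_length (a := 0) (l := fibPrefix n)

theorem fibZeros_pos {n : ℕ} (hn : 0 < n) : 0 < fibZeros n := by
  refine List.count_pos_iff.2 ?_
  have : [0] <+: fibPrefix n :=
    (occursAt_singleton.2 fibWord_zero).prefix_of_length_le (occursAt_fibPrefix n) (by simpa)
  exact this.subset (by simp)

open Real in
-- Self-similarity: with `z = fibZeros n`, the index `k` is `n + z` or `n + z + 1`, and has `n` or
-- `n + 1` zeros before it. As `φ² = φ + 1`, each bound at `k` follows from the opposite one at `n`.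
theorem fibZeros_bounds (n : ℕ) :
    (fibZeros n : ℝ) * goldenRatio < n + 1 ∧ (n : ℝ) + 1 < (fibZeros n + 1) * goldenRatio := by
  have h1 := one_lt_goldenRatio
  have h2 := goldenRatio_sq
  induction n using Nat.strong_induction_on with
  | _ k ih =>
    rcases Nat.eq_zero_or_pos k with rfl | hk
    · simp [fibZeros_zero, h1]
    · obtain ⟨n, hn | ⟨hn, -⟩⟩ := exists_fibImageStart k
      · have hnk : n < k := by
          rw [fibImageStart_eq] at hn
          rcases Nat.eq_zero_or_pos n with rfl | hpos
          · exact hk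
          · have := fibZeros_pos hpos
            omega
        obtain ⟨a, b⟩ := ih n hnk
        rw [hn, fibZeros_fibImageStart, fibImageStart_eq]
        push_cast
        constructor <;> nlinarith
      · have hnk : n < k := by rw [fibImageStart_eq] at hn; omega
        obtain ⟨a, b⟩ := ih n hnk
        rw [hn, fibZeros_fibImageStart_add_one, fibImageStart_eq]
        push_cast
        constructor <;> nlinarith

open Real in
theorem floor_mul_goldenRatio (n : ℕ) :
    ⌊((n + 1 : ℕ) : ℝ) * goldenRatio⌋ = (n : ℤ) + 1 + fibZeros n := by
  have h1 := one_lt_goldenRatio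
  have h2 := goldenRatio_sq
  obtain ⟨a, b⟩ := fibZeros_bounds n
  rw [Int.floor_eq_iff]
  push_cast
  constructor <;> nlinarith

open Real in
theorem floor_mul_goldenRatio_add_one_le (n : ℕ) :
    ⌊(n : ℝ) * goldenRatio⌋ + 1 ≤ ⌊((n + 1 : ℕ) : ℝ) * goldenRatio⌋ := by
  have h1 := one_lt_goldenRatio
  rw [← Int.floor_add_one]
  refine Int.floor_le_floor ?_
  push_cast
  nlinarith

/-- `p⌊nα⌋ + qn + r` with `α` the golden ratio. -/
noncomputable def goldenBeatty (p q r : ℤ) (n : ℕ) : ℤ :=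
  p * ⌊(n : ℝ) * Real.goldenRatio⌋ + q * n + r

theorem isGBS_goldenBeatty (p q r : ℤ) : IsGBS Real.goldenRatio (goldenBeatty p q r) :=
  ⟨p, q, r, fun _ => rfl⟩

theorem goldenBeatty_zero (p q r : ℤ) : goldenBeatty p q r 0 = r := by simp [goldenBeatty]

theorem goldenBeatty_succ (p q r : ℤ) (n : ℕ) :
    goldenBeatty p q r (n + 1) = p * (n + 1 + fibZeros n) + q * (n + 1) + r := by
  rw [goldenBeatty, floor_mul_goldenRatio]
  push_cast
  ring

/-- Since `φ > 1`, the floor grows by at least `1` at each step, so the sequence grows by at least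
`p + q`. -/
theorem strictMono_goldenBeatty {p q : ℤ} (r : ℤ) (hp : 0 ≤ p) (hpq : 0 < p + q) :
    StrictMono (goldenBeatty p q r) := by
  refine strictMono_nat_of_lt_succ fun n => ?_
  have h := floor_mul_goldenRatio_add_one_le n
  have := mul_le_mul_of_nonneg_left h hp
  unfold goldenBeatty
  push_cast at this ⊢
  linarith

/-! ### Letter positions in a morphic image of the Fibonacci word. -/

theorem isFiniteUnionGBS_iUnion {α : ℝ} {ι : Type*} [Finite ι] (V : ι → ℕ → ℤ) (s : ι → ℕ)
    (h : ∀ i, IsGBS α (V i) ∧ (s i = 0 ∨ s i = 1) ∧ StrictMonoOn (V i) (Set.Ici (s i))) :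
    IsFiniteUnionGBS α (⋃ i, V i '' Set.Ici (s i)) := by
  obtain ⟨k, ⟨e⟩⟩ := Finite.exists_equiv_fin ι
  exact ⟨k, fun j => V (e.symm j), fun j => s (e.symm j), fun j => h _,
    (e.symm.surjective.iUnion_comp fun i => V i '' Set.Ici (s i)).symm⟩

theorem length_blockMap_fibPrefix (u v : List ℕ) (k : ℕ) :
    (blockMap u v (fibPrefix k)).length =
      fibZeros k * u.length + (k - fibZeros k) * v.length := by
  induction k with
  | zero => simp [fibZeros_zero]
  | succ k ih =>
    have := fibZeros_le k
    rw [fibPrefix_succ, blockMap_append, List.length_append, ih, blockMap_singleton, fibZeros_succ]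
    split_ifs
    · rw [Nat.add_sub_add_right]
      ring
    · rw [add_zero, Nat.sub_add_comm this]
      ring

/-- The beginning of the block `σ(0)` with index `n` in `σ(x)`. -/
theorem length_blockMap_fibImageStart (u v : List ℕ) (n : ℕ) :
    (blockMap u v (fibPrefix (fibImageStart n))).length =
      n * u.length + fibZeros n * v.length := by
  rw [length_blockMap_fibPrefix, fibZeros_fibImageStart, fibImageStart_eq, Nat.add_sub_cancel_left]

/-- The beginning of the block `σ(1)` with index `n` in `σ(x)`. -/
theorem length_blockMap_fibImageStart_fibImageStart (u v : List ℕ) (n : ℕ) :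
    (blockMap u v (fibPrefix (fibImageStart (fibImageStart n) + 1))).length =
      (n + fibZeros n + 1) * u.length + n * v.length := by
  rw [length_blockMap_fibPrefix, fibZeros_fibImageStart_add_one,
    fibImageStart_eq (fibImageStart n), fibZeros_fibImageStart, fibImageStart_eq]
  congr 2
  omega

theorem length_blockMap_fibPrefix_succ (u v : List ℕ) (k : ℕ) :
    (blockMap u v (fibPrefix (k + 1))).length =
      (blockMap u v (fibPrefix k)).length + (if fibWord k = 0 then u else v).length := by
  rw [fibPrefix_succ, blockMap_append, List.length_append, blockMap_singleton]

theorem exists_mem_block {u v : List ℕ} (hu : u ≠ []) (hv : v ≠ []) (n : ℕ) :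
    ∃ k j, n = (blockMap u v (fibPrefix k)).length + j ∧
      j < (if fibWord k = 0 then u else v).length := by
  induction n with
  | zero =>
    refine ⟨0, 0, rfl, ?_⟩
    split_ifs
    · exact List.length_pos_of_ne_nil hu
    · exact List.length_pos_of_ne_nil hv
  | succ n ih =>
    obtain ⟨k, j, rfl, hj⟩ := ih
    by_cases h : j + 1 < (if fibWord k = 0 then u else v).length
    · exact ⟨k, j + 1, rfl, h⟩
    · refine ⟨k + 1, 0, ?_, ?_⟩
      · rw [length_blockMap_fibPrefix_succ]
        omega
      · split_ifs
        · exact List.length_pos_of_ne_nil hu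
        · exact List.length_pos_of_ne_nil hv

/-- In an infinite word `r σ(x)`, with `r` a suffix of `σ(0)`, the positions of each letter form a
finite union of generalized Beatty sequences. -/
theorem isFiniteUnionGBS_letterPositions {y : ℕ → ℕ} {r u v : List ℕ} (hu : u ≠ []) (hv : v ≠ [])
    (hr : r <:+ u) (hy : ∀ k, OccursAt y (r ++ blockMap u v (fibPrefix k)) 0) (a : ℕ) :
    IsFiniteUnionGBS Real.goldenRatio (letterPositions y a) := by
  have hul := List.length_pos_of_ne_nil hu
  have hvl := List.length_pos_of_ne_nil hv
  obtain ⟨z, rfl⟩ := hr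
  set u := z ++ r with hu_def
  have hlen : u.length = z.length + r.length := by simp [hu_def]
  have hblock : ∀ k, OccursAt y (if fibWord k = 0 then u else v)
      (r.length + (blockMap u v (fibPrefix k)).length) := fun k => by
    have h := hy (k + 1)
    rw [fibPrefix_succ, blockMap_append, ← List.append_assoc, occursAt_append,
      blockMap_singleton, List.length_append, zero_add] at h
    exact h.2
  have hyr : ∀ j (hj : j < r.length), y j = r[j] := fun j hj => by
    have h := occursAt_iff.1 (occursAt_append.1 (hy 0)).1 j hj
    rw [h, zero_add]
  have hyu : ∀ n j (hj : j < u.length),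
      y (r.length + (n * u.length + fibZeros n * v.length) + j) = u[j] := fun n j hj => by
    have h := hblock (fibImageStart n)
    rw [if_pos (fibWord_fibImageStart n), length_blockMap_fibImageStart] at h
    exact (occursAt_iff.1 h j hj).symm
  have hyv : ∀ n j (hj : j < v.length),
      y (r.length + ((n + fibZeros n + 1) * u.length + n * v.length) + j) = v[j] :=
    fun n j hj => by
    have h := hblock (fibImageStart (fibImageStart n) + 1)
    rw [if_neg (by
      rw [fibWord_fibImageStart_add_one (fibWord_fibImageStart n)]; exact one_ne_zero),
      length_blockMap_fibImageStart_fibImageStart] at h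
    exact (occursAt_iff.1 h j hj).symm
  let ι := {j : Fin u.length // u[j] = a} ⊕ {j : Fin v.length // v[j] = a}
  -- One sequence for each place in a block that carries the letter `a`. The value at `n + 1`
  -- belongs to the block of its kind with index `n`, which explains the `- u.length` and `-
  -- v.length`; the `+ 1` makes positions start at `1`.
  let V : ι → ℕ → ℤ := Sum.elim
    (fun j => goldenBeatty v.length (u.length - v.length)
      (r.length - u.length + 1 + (j.1 : ℕ)))
    (fun j => goldenBeatty u.length v.length (r.length - v.length + 1 + (j.1 : ℕ)))
  -- At `n = 0` a sequence for `u` points into the virtual block ending where `r` ends; this value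
  -- is a true position only for places in the suffix `r` of `u = z ++ r`.
  let s : ι → ℕ := Sum.elim (fun j => if z.length ≤ (j.1 : ℕ) then 0 else 1) (fun _ => 1)
  have hV : letterPositions y a = ⋃ i, V i '' Set.Ici (s i) := by
    ext m
    simp only [Set.mem_iUnion, Set.mem_image, Set.mem_Ici]
    constructor
    · rintro ⟨n, hn, rfl⟩
      by_cases hnr : n < r.length
      · refine ⟨Sum.inl ⟨⟨z.length + n, by omega⟩, ?_⟩, 0, ?_, ?_⟩
        · rw [← hn, hyr n hnr]
          simp [hu_def]
        · simp [s]
        · simp only [V, Sum.elim_inl, goldenBeatty_zero, hlen]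
          push_cast
          ring
      · obtain ⟨k, j, hk, hj⟩ := exists_mem_block hu hv (n - r.length)
        obtain rfl : n = r.length + (blockMap u v (fibPrefix k)).length + j := by omega
        by_cases hx : fibWord k = 0
        · obtain ⟨n', rfl⟩ := fibWord_eq_zero_iff.1 hx
          rw [if_pos hx] at hj
          rw [length_blockMap_fibImageStart] at hn ⊢
          refine ⟨Sum.inl ⟨⟨j, hj⟩, ?_⟩, n' + 1, ?_, ?_⟩
          · rw [← hn, hyu n' j hj]
            rfl
          · simp only [s, Sum.elim_inl]
            split_ifs <;> omega
          · simp only [V, Sum.elim_inl, goldenBeatty_succ]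
            push_cast
            ring
        -- A `1` follows the `0` at the start of an image `f(0)`, and the `0` so mapped itself
        -- starts an image; hence two uses of `fibImageStart`.
        · obtain ⟨n', hn', rfl⟩ := fibWord_ne_zero_iff.1 hx
          obtain ⟨n', rfl⟩ := fibWord_eq_zero_iff.1 hn'
          rw [if_neg hx] at hj
          rw [length_blockMap_fibImageStart_fibImageStart] at hn ⊢
          refine ⟨Sum.inr ⟨⟨j, hj⟩, ?_⟩, n' + 1, ?_, ?_⟩
          · rw [← hn, hyv n' j hj]
            rfl
          · simp [s]
          · simp only [V, Sum.elim_inr, goldenBeatty_succ]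
            push_cast
            ring
    · rintro ⟨⟨⟨j, hj⟩, hja⟩ | ⟨⟨j, hj⟩, hja⟩, n, hn, rfl⟩
      · cases n with
        | zero =>
          have hzj : z.length ≤ j := by
            by_contra hcon
            simp [s, hcon] at hn
          refine ⟨j - z.length, ?_, ?_⟩
          · rw [hyr _ (by omega)]
            exact (List.getElem_append_right hzj (bs := r)).symm.trans hja
          · simp only [V, Sum.elim_inl, goldenBeatty_zero, hlen]
            push_cast [hzj]
            ring
        | succ n =>
          refine ⟨_, (hyu n j hj).trans hja, ?_⟩
          simp only [V, Sum.elim_inl, goldenBeatty_succ]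
          push_cast
          ring
      · cases n with
        | zero => simp [s] at hn
        | succ n =>
          refine ⟨_, (hyv n j hj).trans hja, ?_⟩
          simp only [V, Sum.elim_inr, goldenBeatty_succ]
          push_cast
          ring
  rw [hV]
  refine isFiniteUnionGBS_iUnion V s ?_
  rintro (j | j)
  · refine ⟨isGBS_goldenBeatty _ _ _, ?_, (strictMono_goldenBeatty _ ?_ ?_).strictMonoOn _⟩
    · simp only [s, Sum.elim_inl]
      split_ifs <;> simp
    · positivity
    · simp only [add_sub_cancel]
      exact_mod_cast hul
  · refine ⟨isGBS_goldenBeatty _ _ _, Or.inr rfl, (strictMono_goldenBeatty _ ?_ ?_).strictMonoOn _⟩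
    · positivity
    · positivity

/-! ### The effect of replacing `w` by a letter. -/

section Replacement

variable {A : Type*} [DecidableEq A] {x : ℕ → A} {w : List A}

theorem replaceStart_add {n i d : ℕ} (hn : replaceStart x w n = i)
    (h : ∀ j < d, ¬ OccursAt x w (i + j)) : ∀ j ≤ d, replaceStart x w (n + j) = i + j := by
  intro j
  induction j with
  | zero => exact fun _ => hn
  | succ j ih =>
    intro hj
    rw [← add_assoc, replaceStart, ih (by omega), if_neg (h j (by omega)), add_assoc]

/-- A stretch of `x` that meets no beginning of an occurrence of `w` is copied. -/
theorem occursAt_wordReplace {l : List A} {c : A} {n i : ℕ} (hn : replaceStart x w n = i)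
    (hl : OccursAt x l i) (h : ∀ j < l.length, ¬ OccursAt x w (i + j)) :
    OccursAt (wordReplace w c x) l n ∧ replaceStart x w (n + l.length) = i + l.length := by
  have hstart := replaceStart_add hn h
  refine ⟨occursAt_iff.2 fun j hj => ?_, hstart _ le_rfl⟩
  rw [wordReplace, hstart j hj.le, if_neg (h j hj)]
  exact occursAt_iff.1 hl j hj

/-- An occurrence of `w` followed by a stretch that meets no beginning of an occurrence of `w`. -/
theorem occursAt_wordReplace_cons {l : List A} {c : A} {n i : ℕ} (hn : replaceStart x w n = i)
    (hl : OccursAt x (w ++ l) i)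
    (h : ∀ j < l.length, ¬ OccursAt x w (i + w.length + j)) :
    OccursAt (wordReplace w c x) (c :: l) n ∧
      replaceStart x w (n + (c :: l).length) = i + (w ++ l).length := by
  obtain ⟨h1, h2⟩ := occursAt_append.1 hl
  have hsucc : replaceStart x w (n + 1) = i + w.length := by
    rw [replaceStart, hn, if_pos h1]
  obtain ⟨h3, h4⟩ := occursAt_wordReplace (c := c) hsucc h2 h
  refine ⟨occursAt_cons.2 ⟨?_, h3⟩, ?_⟩
  · rw [wordReplace, hn, if_pos h1]
  · rw [List.length_cons, add_comm l.length, ← add_assoc, h4, List.length_append, add_assoc]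

end Replacement

namespace IsReturnDecomposition

variable {w r u v : List ℕ}

theorem length_succ (r u v : List ℕ) (k : ℕ) :
    (r ++ blockMap u v (fibPrefix (k + 1))).length =
      (r ++ blockMap u v (fibPrefix k)).length + (if fibWord k = 0 then u else v).length := by
  rw [fibPrefix_succ, blockMap_append, ← List.append_assoc, List.length_append,
    blockMap_singleton]

theorem block_length_pos (h : IsReturnDecomposition w r u v) (k : ℕ) :
    0 < (if fibWord k = 0 then u else v).length := by
  split_ifs
  · exact List.length_pos_of_ne_nil h.left_ne_nil
  · exact List.length_pos_of_ne_nil h.right_ne_nil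

theorem strictMono (h : IsReturnDecomposition w r u v) :
    StrictMono fun k => (r ++ blockMap u v (fibPrefix k)).length :=
  strictMono_nat_of_lt_succ fun k => by
    have := h.block_length_pos k
    rw [length_succ]
    omega

theorem occursAt_start (h : IsReturnDecomposition w r u v) (k : ℕ) :
    OccursAt fibWord w (r ++ blockMap u v (fibPrefix k)).length :=
  (h.occursAt_iff _).2 ⟨k, rfl⟩

theorem occursAt_block (h : IsReturnDecomposition w r u v) (k : ℕ) :
    OccursAt fibWord (if fibWord k = 0 then u else v)
      (r ++ blockMap u v (fibPrefix k)).length := by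
  have h := h.occursAt (k + 1)
  rw [fibPrefix_succ, blockMap_append, ← List.append_assoc, occursAt_append,
    blockMap_singleton, zero_add] at h
  exact h.2

theorem not_occursAt_of_lt (h : IsReturnDecomposition w r u v) {i : ℕ} (hi : i < r.length) :
    ¬ OccursAt fibWord w i := by
  rw [h.occursAt_iff]
  rintro ⟨k, rfl⟩
  simp at hi

theorem not_occursAt_of_between (h : IsReturnDecomposition w r u v) {i k : ℕ}
    (h1 : (r ++ blockMap u v (fibPrefix k)).length < i)
    (h2 : i < (r ++ blockMap u v (fibPrefix (k + 1))).length) : ¬ OccursAt fibWord w i := by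
  rw [h.occursAt_iff]
  rintro ⟨m, rfl⟩
  have a := h.strictMono.lt_iff_lt.1 h1
  have b := h.strictMono.lt_iff_lt.1 h2
  omega

theorem nth_occursAt (h : IsReturnDecomposition w r u v) (k : ℕ) :
    Nat.nth (OccursAt fibWord w) k = (r ++ blockMap u v (fibPrefix k)).length := by
  have hcount : Nat.count (OccursAt fibWord w) (r ++ blockMap u v (fibPrefix k)).length = k := by
    rw [Nat.count_eq_card_filter_range]
    have : (Finset.range (r ++ blockMap u v (fibPrefix k)).length).filter (OccursAt fibWord w) =
        (Finset.range k).map ⟨_, h.strictMono.injective⟩ := by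
      ext i
      simp only [Finset.mem_filter, Finset.mem_range, Finset.mem_map,
        Function.Embedding.coeFn_mk, h.occursAt_iff]
      constructor
      · rintro ⟨hi, m, rfl⟩
        exact ⟨m, h.strictMono.lt_iff_lt.1 hi, rfl⟩
      · rintro ⟨m, hm, rfl⟩
        exact ⟨h.strictMono hm, m, rfl⟩
    rw [this, Finset.card_map, Finset.card_range]
  conv_lhs => rw [← hcount]
  exact Nat.nth_count (h.occursAt_start k)

/-- If `w` has no overlap, then every return word begins with `w`. -/
theorem prefix_block (h : IsReturnDecomposition w r u v) (hno : ¬ HasOverlap fibWord w) (k : ℕ) :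
    w <+: if fibWord k = 0 then u else v := by
  refine (h.occursAt_start k).prefix_of_length_le (h.occursAt_block k) ?_
  -- The next occurrence starts one block later; a block shorter than `w` would make the two
  -- overlap.
  by_contra! hlt
  refine hno (hasOverlap_of_occursAt (h.occursAt_start k) ?_ (h.block_length_pos k) hlt)
  rw [← length_succ]
  exact h.occursAt_start (k + 1)

/-- Reading from left to right arrives at each block start without skipping it, because each block
has `w` as a prefix and no other occurrence begins inside it. So `w` becomes `c`, and `r`, `s`, `t`
are copied. -/
theorem occursAt_wordReplace {s t : List ℕ}
    (h : IsReturnDecomposition w r (w ++ s) (w ++ t)) (hw : w ≠ []) (c k : ℕ) :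
    OccursAt (wordReplace w c fibWord) (r ++ blockMap (c :: s) (c :: t) (fibPrefix k)) 0 ∧
      replaceStart fibWord w (r ++ blockMap (c :: s) (c :: t) (fibPrefix k)).length =
        (r ++ blockMap (w ++ s) (w ++ t) (fibPrefix k)).length := by
  have hwl := List.length_pos_of_ne_nil hw
  induction k with
  | zero =>
    have := _root_.occursAt_wordReplace (c := c) (n := 0) (i := 0) rfl
      (occursAt_append.1 (h.occursAt 0)).1
      fun j hj => by
        rw [zero_add]
        exact h.not_occursAt_of_lt hj
    simpa using this
  | succ k ih =>
    obtain ⟨ih1, ih2⟩ := ih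
    have e1 : (if fibWord k = 0 then w ++ s else w ++ t) = w ++ if fibWord k = 0 then s else t := by
      split_ifs <;> rfl
    have e2 : (if fibWord k = 0 then c :: s else c :: t) =
        c :: if fibWord k = 0 then s else t := by
      split_ifs <;> rfl
    have hocc := h.occursAt_block k
    have hlen := length_succ r (w ++ s) (w ++ t) k
    have hlen' := length_succ r (c :: s) (c :: t) k
    rw [e1] at hocc hlen
    rw [e2] at hlen'
    obtain ⟨h3, h4⟩ := occursAt_wordReplace_cons (c := c) ih2 hocc fun j hj => by
      refine h.not_occursAt_of_between (k := k) (by omega) ?_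
      have := List.length_append (as := w) (bs := if fibWord k = 0 then s else t)
      omega
    refine ⟨?_, by rw [hlen', hlen, h4]⟩
    rw [fibPrefix_succ, blockMap_append, ← List.append_assoc, occursAt_append,
      blockMap_singleton, zero_add, e2]
    exact ⟨ih1, h3⟩

end IsReturnDecomposition

/-! ### Conclusion. -/

theorem isFiniteUnionGBS_letterPositions_wordReplace {w : List ℕ} (hw : w ≠ [])
    (hfac : IsFactor fibWord w) (hno : ¬ HasOverlap fibWord w)
    (hSR0 : ((returnWord fibWord w 0).length : ℤ)
      ≤ ((returnWord fibWord w 1).length : ℤ) - (w.length : ℤ)) (c a : ℕ) :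
    IsFiniteUnionGBS Real.goldenRatio (letterPositions (wordReplace w c fibWord) a) := by
  obtain ⟨r, u, v, h⟩ := exists_isReturnDecomposition w hfac
  -- As `x` starts with `01`, the blocks with indices `0` and `1` are `u` and `v`.
  obtain ⟨s, rfl⟩ : w <+: u := by
    simpa [fibWord_zero] using h.prefix_block hno 0
  obtain ⟨t, rfl⟩ : w <+: v := by
    simpa [fibWord_one] using h.prefix_block hno 1
  -- Here `r₀(w)` has length `|r|` and `r₁(w)` has length `|ws|`, so (SR0) is this inequality.
  have hrs : r.length ≤ s.length := by
    have h0 := h.nth_occursAt 0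
    have h1 := h.nth_occursAt 1
    rw [IsReturnDecomposition.length_succ, if_pos fibWord_zero, ← h0] at h1
    simp only [fibPrefix_zero, blockMap_nil, List.append_nil] at h0
    simp only [returnWord, length_wordSegment, h1, zero_add] at hSR0
    rw [h0] at hSR0
    simp at hSR0
    omega
  have hsuff : r <:+ s := by
    obtain ⟨W, hr, hu⟩ := h.suffix
    exact List.suffix_of_suffix_length_le hr ((List.suffix_append w s).trans hu) hrs
  exact isFiniteUnionGBS_letterPositions (List.cons_ne_nil c s) (List.cons_ne_nil c t)
    (hsuff.trans (List.suffix_cons c s)) (fun k => (h.occursAt_wordReplace hw c k).1) a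

theorem mainTheorem12 (w : List ℕ) (hw : w ≠ []) (hfac : IsFactor fibWord w)
    (hno : ¬ HasOverlap fibWord w)
    (hSR0 : ((returnWord fibWord w 0).length : ℤ)
      ≤ ((returnWord fibWord w 1).length : ℤ) - (w.length : ℤ)) :
    IsFiniteUnionGBS Real.goldenRatio (letterPositions (wordReplace w 2 fibWord) 0) ∧
    IsFiniteUnionGBS Real.goldenRatio (letterPositions (wordReplace w 2 fibWord) 1) ∧
    IsFiniteUnionGBS Real.goldenRatio (letterPositions (wordReplace w 2 fibWord) 2) :=
  ⟨isFiniteUnionGBS_letterPositions_wordReplace hw hfac hno hSR0 2 0,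
    isFiniteUnionGBS_letterPositions_wordReplace hw hfac hno hSR0 2 1,
    isFiniteUnionGBS_letterPositions_wordReplace hw hfac hno hSR0 2 2⟩
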